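/- Permutations of length $n$ are written as words $\pi_1\pi_2\cdots\pi_n$, and $S_n$ denotes the set of all of them. The pattern of a finite sequence of distinct numbers is the permutation whose entries are in the same relative order. A permutation $\pi$ avoids $\sigma$ if no subsequence of $\pi$ has pattern $\sigma$. A pattern avoidance class is a set $\mathrm{Av}(B)$ of all permutations that avoid every member of some set $B$ of permutations; it is proper if it does not contain all permutations. For a pattern avoidance class $\mathcal A$ and a permutation $\pi$, let $L_{\mathcal A}(\pi)$ be the maximum length of a subsequence of $\pi$ whose pattern belongs to $\mathcal A$ (and $0$ if there is none), and let $\Pi_n$ be uniformly distributed over $S_n$. Define $s_{\mathcal A}, c_{\mathcal A}\in[0,\infty]$ by $$s_{\mathcal A}=\limsup_{n\to\infty}|S_n\cap\mathcal A|^{1/n},\qquad 2\sqrt{c_{\mathcal A}}=\limsup_{n\to\infty}\frac{\mathbf E\,L_{\mathcal A}(\Pi_n)}{\sqrt n}.$$ Say that $\mathcal A$ satisfies the conjecture if both limits superior are in fact limits (in $[0,\infty]$) and $c_{\mathcal A}=s_{\mathcal A}$. Let $\mathrm{Rot}(\mathcal A)$ be the set of all cyclic rotations $\pi_{k+1}\cdots\pi_n\pi_1\cdots\pi_k$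 of members $\pi_1\cdots\pi_n$ of $\mathcal A$. **Proposition.** Let $\mathcal A$ be a pattern avoidance class that satisfies the conjecture. Then $\mathrm{Rot}(\mathcal A)$ is a pattern avoidance class, which is proper if $\mathcal A$ is proper; $\mathrm{Rot}(\mathcal A)$ satisfies the conjecture; and $c_{\mathrm{Rot}(\mathcal A)}=c_{\mathcal A}$ and $s_{\mathrm{Rot}(\mathcal A)}=s_{\mathcal A}$. -/

import Mathlib

open Filter Topology
open scoped ENNReal

/-- A set of (finite) permutations, given by its members of each length `n`. A permutation `π` of
length `n` is the word `π 0, π 1, …, π (n - 1)`. -/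
abbrev PermSet : Type := (n : ℕ) → Set (Equiv.Perm (Fin n))

/-- `σ` is the pattern of the sequence `x` : the entries of both are in the same relative order. -/
def HasPattern {α : Type*} [LT α] {k : ℕ} (x : Fin k → α) (σ : Equiv.Perm (Fin k)) : Prop :=
  ∀ s t : Fin k, σ s < σ t ↔ x s < x t

/-- `σ` occurs as a pattern in `π` (is involved in `π`): some subsequence of `π`, at positions
`f 0 < f 1 < ⋯`, has pattern `σ`. -/
def Involved {k n : ℕ} (σ : Equiv.Perm (Fin k)) (π : Equiv.Perm (Fin n)) : Prop :=
  ∃ f : Fin k ↪o Fin n, HasPattern (fun s => π (f s)) σ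

/-- `Av(B)`: all permutations that avoid every member of `B`. -/
def Av (B : PermSet) : PermSet :=
  fun _ => {π | ∀ (k : ℕ), ∀ σ ∈ B k, ¬ Involved σ π}

/-- Pattern avoidance classes are the sets `Av(B)`. -/
def IsPatternClass (A : PermSet) : Prop := ∃ B : PermSet, A = Av B

/-- `A` does not contain all permutations. -/
def IsProper (A : PermSet) : Prop := ∃ (n : ℕ) (π : Equiv.Perm (Fin n)), π ∉ A n

/-- `L_A(π)`: the maximum length of a subsequence of `π` whose pattern belongs to `A`. -/
noncomputable def longestLength (A : PermSet) {n : ℕ} (π : Equiv.Perm (Fin n)) : ℕ :=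
  sSup {k | ∃ f : Fin k ↪o Fin n, ∃ σ ∈ A k, HasPattern (fun s => π (f s)) σ}

/-- The set in the definition of `longestLength` is bounded, so that its supremum is a maximum
as soon as it is nonempty. -/
theorem longestLength_bddAbove (A : PermSet) {n : ℕ} (π : Equiv.Perm (Fin n)) :
    BddAbove {k | ∃ f : Fin k ↪o Fin n, ∃ σ ∈ A k, HasPattern (fun s => π (f s)) σ} := by
  refine ⟨n, ?_⟩
  rintro k ⟨f, -⟩
  simpa using Fintype.card_le_of_injective f f.injective

/-- `E L_A(Π_n)`, for `Π_n` uniformly distributed over the `n!` permutations of length `n`. -/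
noncomputable def meanLongest (A : PermSet) (n : ℕ) : ℝ :=
  (∑ π : Equiv.Perm (Fin n), (longestLength A π : ℝ)) / (n.factorial : ℝ)

/-- `E L_A(Π_n) / √n`, as an extended nonnegative real number. -/
noncomputable def scaledMean (A : PermSet) (n : ℕ) : ℝ≥0∞ :=
  ENNReal.ofReal (meanLongest A n / Real.sqrt n)

/-- `|S_n ∩ A| ^ (1 / n)`, as an extended nonnegative real number. -/
noncomputable def growthRoot (A : PermSet) (n : ℕ) : ℝ≥0∞ :=
  ((A n).ncard : ℝ≥0∞) ^ (1 / (n : ℝ))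

/-- The Stanley-Wilf limit `s_A = limsup |S_n ∩ A| ^ (1 / n)`. -/
noncomputable def stanleyWilf (A : PermSet) : ℝ≥0∞ := limsup (growthRoot A) atTop

/-- The constant `c_A` with `2 √c_A = limsup E L_A(Π_n) / √n`. -/
noncomputable def lsConst (A : PermSet) : ℝ≥0∞ := (limsup (scaledMean A) atTop / 2) ^ 2

/-- The limits superior that define `c_A` and `s_A` are limits, and `c_A = s_A`. -/
def SatisfiesConjecture (A : PermSet) : Prop :=
  Tendsto (scaledMean A) atTop (𝓝 (limsup (scaledMean A) atTop)) ∧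
  Tendsto (growthRoot A) atTop (𝓝 (limsup (growthRoot A) atTop)) ∧
  lsConst A = stanleyWilf A

/-- `Rot(A)`: all cyclic rotations `π k, …, π (n - 1), π 0, …, π (k - 1)` of members `π` of `A`. -/
def Rot (A : PermSet) : PermSet :=
  fun n => {ρ | ∃ π ∈ A n, ∃ k : ℕ, ρ = π * finRotate n ^ k}

/-! A subsequence of `π` has pattern in `Rot A` exactly when it splits as `u ++ v` with the pattern
of `v ++ u` in `A`. For counting, each member of `A` has at most `n` rotations, so the growth root
changes by a factor of at most `n ^ (1 / n)`, which tends to `1`.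

For the means, `A ⊆ Rot A` gives the lower bound. For the upper bound, cut `π` where `u` ends and
`v` begins, and round the cut down to a multiple of a block length `b` of about `n / M`. Apart from
the part of `u` inside one block, `v ++ u` is then a subsequence of one of at most `M + 1` fixed
rotations of `π` (`longestLength_rot_le`). Each rotation of a uniform permutation is uniform, so `E
L_{Rot A}` exceeds `E L_A` by at most the mean for one block, of order `√(n / M)`, plus about `M`
mean absolute deviations (`meanLongest_rot_le`).

The deviations are `o(√n)`: the entries of a longest subsequence certify its length, and a variance
bound for certified functions (`IsCertifiedBy.sum_sq_le`) gives order `√(√n log n)` when the means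
are `O(√n)`. Let `n → ∞` and then `M → ∞`. If the limit is infinite, the lower bound suffices. -/

/-! ### Patterns of words -/

section Words

variable {α β : Type*}

theorem HasPattern.comp_perm [LT α] {k : ℕ} {x : Fin k → α} {σ : Equiv.Perm (Fin k)}
    (h : HasPattern x σ) (ρ : Equiv.Perm (Fin k)) : HasPattern (x ∘ ρ) (σ * ρ) :=
  fun s t => h (ρ s) (ρ t)

theorem HasPattern.trans [LT α] {k n : ℕ} {x : Fin n → α} {τ : Equiv.Perm (Fin n)}
    {σ : Equiv.Perm (Fin k)} (h : HasPattern x τ) {f : Fin k → Fin n}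
    (hσ : HasPattern (fun s => τ (f s)) σ) : HasPattern (x ∘ f) σ :=
  fun s t => (hσ s t).trans (h (f s) (f t))

theorem HasPattern.of_trans [LT α] {k n : ℕ} {x : Fin n → α} {τ : Equiv.Perm (Fin n)}
    {σ : Equiv.Perm (Fin k)} (h : HasPattern x τ) {f : Fin k → Fin n}
    (hσ : HasPattern (x ∘ f) σ) : HasPattern (fun s => τ (f s)) σ :=
  fun s t => (hσ s t).trans (h (f s) (f t)).symm

theorem hasPattern_self {n : ℕ} (π : Equiv.Perm (Fin n)) : HasPattern π π :=
  fun _ _ => Iff.rfl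

/-- The word `π * σ⁻¹` is increasing and onto, hence the identity. -/
theorem hasPattern_perm_iff {n : ℕ} {π σ : Equiv.Perm (Fin n)} : HasPattern π σ ↔ π = σ := by
  refine ⟨fun h => ?_, fun h => h ▸ hasPattern_self π⟩
  have hm : StrictMono (fun i => π (σ⁻¹ i)) := fun a b hab => (h _ _).1 (by simpa using hab)
  have := (StrictMono.range_inj hm strictMono_id).1
    (by rw [(show (fun i => π (σ⁻¹ i)) = ⇑(π * σ⁻¹) from rfl), (π * σ⁻¹).surjective.range_eq,
      Set.range_id])
  ext1 i
  simpa using congrFun this (σ i)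

theorem exists_hasPattern [LinearOrder α] {k : ℕ} {x : Fin k → α} (hx : Function.Injective x) :
    ∃ σ : Equiv.Perm (Fin k), HasPattern x σ := by
  refine ⟨(Tuple.sort x)⁻¹, fun s t => ?_⟩
  have hm : StrictMono (x ∘ Tuple.sort x) :=
    (Tuple.monotone_sort x).strictMono_of_injective (hx.comp (Equiv.injective _))
  simpa using (hm.lt_iff_lt (a := (Tuple.sort x)⁻¹ s) (b := (Tuple.sort x)⁻¹ t)).symm

theorem HasPattern.injective [LinearOrder α] {k : ℕ} {x : Fin k → α} {σ : Equiv.Perm (Fin k)}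
    (h : HasPattern x σ) : Function.Injective x := by
  intro s t hst
  apply σ.injective
  by_contra hne
  rcases lt_or_gt_of_ne hne with hlt | hlt
  · exact ((h s t).1 hlt).ne hst
  · exact ((h t s).1 hlt).ne hst.symm

end Words

/-! ### Pattern classes are the sets closed under involvement -/

/-- `A` contains every permutation that is involved in a member of `A`. -/
def IsHereditary (A : PermSet) : Prop :=
  ∀ ⦃k n : ℕ⦄ ⦃σ : Equiv.Perm (Fin k)⦄ ⦃π : Equiv.Perm (Fin n)⦄, Involved σ π → π ∈ A n → σ ∈ A k

theorem Involved.refl {n : ℕ} (π : Equiv.Perm (Fin n)) : Involved π π :=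
  ⟨OrderEmbedding.ofStrictMono id strictMono_id, hasPattern_self π⟩

theorem Involved.trans {k m n : ℕ} {ρ : Equiv.Perm (Fin k)} {σ : Equiv.Perm (Fin m)}
    {π : Equiv.Perm (Fin n)} : Involved ρ σ → Involved σ π → Involved ρ π := by
  rintro ⟨f, hf⟩ ⟨g, hg⟩
  exact ⟨f.trans g, HasPattern.trans hg hf⟩

theorem isPatternClass_iff {A : PermSet} : IsPatternClass A ↔ IsHereditary A := by
  constructor
  · rintro ⟨B, rfl⟩ k n σ π h hπ j τ hτ hi
    exact hπ j τ hτ (hi.trans h)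
  · intro h
    -- The complement of `A` serves as the set of forbidden patterns.
    refine ⟨fun n => {π | π ∉ A n}, ?_⟩
    funext n
    ext π
    refine ⟨fun hπ k σ hσ hi => hσ (h hi hπ), fun hπ => ?_⟩
    by_contra hn
    exact hπ n π hn (.refl π)

/-! ### Words as lists -/

section Lists

variable {α : Type*}

/-- The pattern of the list `l` belongs to `A`. -/
def ListIn [LT α] (A : PermSet) (l : List α) : Prop :=
  ∃ (k : ℕ) (x : Fin k → α), l = List.ofFn x ∧ ∃ σ ∈ A k, HasPattern x σ

theorem listIn_ofFn [LT α] {A : PermSet} {n : ℕ} {x : Fin n → α} :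
    ListIn A (List.ofFn x) ↔ ∃ σ ∈ A n, HasPattern x σ := by
  refine ⟨?_, fun h => ⟨n, x, rfl, h⟩⟩
  rintro ⟨k, y, hxy, h⟩
  have := List.ofFn_inj'.1 hxy
  cases this
  exact h

theorem listIn_ofFn_perm {A : PermSet} {n : ℕ} {π : Equiv.Perm (Fin n)} :
    ListIn A (List.ofFn π) ↔ π ∈ A n := by
  rw [listIn_ofFn]
  exact ⟨fun ⟨σ, hσ, h⟩ => hasPattern_perm_iff.1 h ▸ hσ, fun h => ⟨π, h, hasPattern_self π⟩⟩

theorem sublist_ofFn_iff {n : ℕ} {x : Fin n → α} {s : List α} :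
    s.Sublist (List.ofFn x) ↔ ∃ (k : ℕ) (f : Fin k ↪o Fin n), s = List.ofFn (x ∘ f) := by
  rw [List.sublist_iff_exists_fin_orderEmbedding_get_eq]
  constructor
  · rintro ⟨f, hf⟩
    refine ⟨s.length, f.trans (Fin.castOrderIso (List.length_ofFn (f := x))).toOrderEmbedding, ?_⟩
    refine (List.ofFn_get s).symm.trans (congrArg List.ofFn (funext fun i => ?_))
    rw [hf i]
    simp [Fin.cast]
  · rintro ⟨k, f, rfl⟩
    refine ⟨((Fin.castOrderIso (by simp)).toOrderEmbedding.trans f).trans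
      (Fin.castOrderIso (List.length_ofFn (f := x)).symm).toOrderEmbedding, fun i => ?_⟩
    simp [Fin.cast]

theorem ListIn.sublist [LinearOrder α] {A : PermSet} (hA : IsHereditary A) {s l : List α}
    (hl : ListIn A l) (hs : s.Sublist l) : ListIn A s := by
  obtain ⟨n, x, rfl, σ, hσ, hx⟩ := hl
  obtain ⟨k, f, rfl⟩ := sublist_ofFn_iff.1 hs
  obtain ⟨τ, hτ⟩ := exists_hasPattern (hx.injective.comp f.injective)
  exact ⟨k, _, rfl, τ, hA ⟨f, hx.of_trans hτ⟩ hσ, hτ⟩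

/-! ### Rotations of permutations as rotations of lists -/

theorem val_finRotate_pow (n k : ℕ) (i : Fin n) :
    ((finRotate n ^ k) i : ℕ) = (i + k) % n := by
  have := i.neZero
  induction k with
  | zero => simp [Nat.mod_eq_of_lt i.isLt]
  | succ k ih =>
    rw [pow_succ', Equiv.Perm.mul_apply, finRotate_apply, Fin.val_add, ih]
    simp [← add_assoc]

theorem ofFn_comp_finRotate_pow {n : ℕ} (x : Fin n → α) (k : ℕ) :
    List.ofFn (x ∘ ⇑(finRotate n ^ k)) = (List.ofFn x).rotate k := by
  apply List.ext_getElem (by simp)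
  intro i h₁ h₂
  simp only [List.getElem_ofFn, List.getElem_rotate, Function.comp_apply]
  congr 1
  ext
  simp [val_finRotate_pow]

theorem exists_finRotate_pow_mul (n k : ℕ) : ∃ j, finRotate n ^ k * finRotate n ^ j = 1 := by
  have h := orderOf_pos (finRotate n)
  refine ⟨orderOf (finRotate n) * k - k, ?_⟩
  rw [← pow_add, Nat.add_sub_cancel' (Nat.le_mul_of_pos_left k h), pow_mul, pow_orderOf_eq_one,
    one_pow]

theorem listIn_rot_iff [LinearOrder α] {A : PermSet} {l : List α} :
    ListIn (Rot A) l ↔ ∃ j, ListIn A (l.rotate j) := by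
  constructor
  · rintro ⟨n, x, rfl, _, ⟨π, hπ, k, rfl⟩, hx⟩
    obtain ⟨j, hj⟩ := exists_finRotate_pow_mul n k
    refine ⟨j, ?_⟩
    rw [← ofFn_comp_finRotate_pow, listIn_ofFn]
    refine ⟨π, hπ, ?_⟩
    simpa [mul_assoc, hj] using hx.comp_perm (finRotate n ^ j)
  · rintro ⟨j, h⟩
    refine ⟨l.length, l.get, (List.ofFn_get l).symm, ?_⟩
    rw [← List.ofFn_get l, ← ofFn_comp_finRotate_pow, listIn_ofFn] at h
    obtain ⟨π, hπ, hx⟩ := h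
    obtain ⟨k, hk⟩ := exists_finRotate_pow_mul l.length j
    refine ⟨_, ⟨π, hπ, k, rfl⟩, ?_⟩
    have := hx.comp_perm (finRotate l.length ^ k)
    rwa [Function.comp_assoc, ← Equiv.Perm.coe_mul, hk, Equiv.Perm.coe_one,
      Function.comp_id] at this

/-- The form used from here on: sublists respect the cut into `u` and `v`, so no rotation index has
to be tracked. -/
theorem listIn_rot_iff_append [LinearOrder α] {A : PermSet} {l : List α} :
    ListIn (Rot A) l ↔ ∃ u v, l = u ++ v ∧ ListIn A (v ++ u) := by
  rw [listIn_rot_iff]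
  constructor
  · rintro ⟨j, h⟩
    rw [List.rotate_eq_drop_append_take_mod] at h
    exact ⟨_, _, (List.take_append_drop _ _).symm, h⟩
  · rintro ⟨u, v, rfl, h⟩
    exact ⟨u.length, by rwa [List.rotate_append_length_eq]⟩

end Lists

/-! ### `Rot A` is a pattern class, proper if `A` is -/

theorem IsHereditary.rot {A : PermSet} (hA : IsHereditary A) : IsHereditary (Rot A) := by
  rintro k n σ π ⟨f, hf⟩ hπ
  rw [← listIn_ofFn_perm, listIn_rot_iff_append] at hπ
  obtain ⟨u, v, huv, h⟩ := hπ
  have hs : (List.ofFn (π ∘ f)).Sublist (u ++ v) := huv ▸ sublist_ofFn_iff.2 ⟨k, f, rfl⟩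
  obtain ⟨a, b, hab, ha, hb⟩ := List.sublist_append_iff.1 hs
  have h' : ListIn (Rot A) (List.ofFn (π ∘ f)) :=
    listIn_rot_iff_append.2 ⟨a, b, hab, h.sublist hA (hb.append ha)⟩
  obtain ⟨τ, hτ, hfτ⟩ := listIn_ofFn.1 h'
  have : σ = τ := hasPattern_perm_iff.1 fun s t => (hfτ s t).trans (hf s t).symm
  exact this ▸ hτ

theorem subset_rot (A : PermSet) (n : ℕ) : A n ⊆ Rot A n := fun π hπ => ⟨π, hπ, 0, by simp⟩

/-- If `α ∉ A`, the direct sum of `α` with itself is not in `Rot A`: a single cut leaves one of the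
two copies of `α` intact, and heredity would put `α` in `A`. -/
theorem IsHereditary.isProper_rot {A : PermSet} (hA : IsHereditary A) (h : IsProper A) :
    IsProper (Rot A) := by
  obtain ⟨n, α, hα⟩ := h
  set x : Fin n → Fin (n + n) := fun i => Fin.castAdd n (α i) with hx
  set y : Fin n → Fin (n + n) := fun i => Fin.natAdd n (α i) with hy
  have hxα : HasPattern x α := fun s t => Iff.rfl
  have hyα : HasPattern y α := fun s t => (Nat.add_lt_add_iff_left (k := n)).symm
  have key : ∀ z : Fin n → Fin (n + n), HasPattern z α → ¬ ListIn A (List.ofFn z) := by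
    intro z hz hin
    obtain ⟨τ, hτ, hzτ⟩ := listIn_ofFn.1 hin
    have : α = τ := hasPattern_perm_iff.1 fun s t => (hzτ s t).trans (hz s t).symm
    exact hα (this ▸ hτ)
  set β : Equiv.Perm (Fin (n + n)) :=
    finSumFinEquiv.symm.trans ((Equiv.sumCongr α α).trans finSumFinEquiv) with hβ
  refine ⟨n + n, β, fun hin => ?_⟩
  have hlist : List.ofFn β = List.ofFn x ++ List.ofFn y := by
    rw [← List.ofFn_fin_append]
    congr 1
    funext i
    refine Fin.addCases (fun i => ?_) (fun i => ?_) i <;> simp [hβ, hx, hy, -Fin.natAdd_eq_addNat]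
  rw [← listIn_ofFn_perm, listIn_rot_iff_append, hlist] at hin
  obtain ⟨u, v, huv, h⟩ := hin
  -- Either the first copy lies wholly in `u`, or the second lies wholly in `v`.
  rcases List.append_eq_append_iff.1 huv with ⟨c, hu, -⟩ | ⟨c, -, hv⟩
  · refine key x hxα (h.sublist hA ?_)
    rw [hu]
    exact (List.sublist_append_left _ _).trans (List.sublist_append_right _ _)
  · refine key y hyα (h.sublist hA ?_)
    rw [hv]
    exact (List.sublist_append_right _ _).trans (List.sublist_append_left _ _)

/-! ### A variance bound for functions of a uniform permutation -/

section Variance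

open Finset

/-- Expanding a sum of squares about the mean `m`. -/
theorem sum_sq_sub_eq {ι : Type*} (s : Finset ι) (f : ι → ℝ) (m c : ℝ)
    (hm : #s * m = ∑ i ∈ s, f i) :
    ∑ i ∈ s, (f i - c) ^ 2 = ∑ i ∈ s, (f i - m) ^ 2 + #s * (m - c) ^ 2 := by
  have h : ∀ i ∈ s, (f i - c) ^ 2 = (f i - m) ^ 2 + (2 * (m - c) * f i
      + (- 2 * (m - c) * m + (m - c) ^ 2)) := fun i _ => by ring
  rw [sum_congr rfl h, sum_add_distrib, sum_add_distrib, ← mul_sum, ← hm, sum_const, nsmul_eq_mul]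
  ring

/-- The sum of squares about the mean is a sum over pairs. -/
theorem sum_sum_sq_sub {ι : Type*} (s : Finset ι) (f : ι → ℝ) (m : ℝ)
    (hm : #s * m = ∑ i ∈ s, f i) :
    ∑ i ∈ s, ∑ j ∈ s, (f i - f j) ^ 2 = 2 * #s * ∑ i ∈ s, (f i - m) ^ 2 := by
  have h : ∀ j ∈ s, ∑ i ∈ s, (f i - f j) ^ 2 = ∑ i ∈ s, (f i - m) ^ 2 + #s * (f j - m) ^ 2 :=
    fun j _ => by rw [sum_sq_sub_eq s f m _ hm]; ring
  rw [sum_comm, sum_congr rfl h, sum_add_distrib, ← mul_sum, sum_const, nsmul_eq_mul]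
  ring

/-- The pairs may be restricted to those with a positive difference. -/
theorem sum_sum_max_sq {ι : Type*} (s : Finset ι) (f : ι → ℝ) :
    ∑ i ∈ s, ∑ j ∈ s, (f i - f j) ^ 2 = 2 * ∑ i ∈ s, ∑ j ∈ s, (max (f i - f j) 0) ^ 2 := by
  have h : ∀ i ∈ s, ∀ j ∈ s,
      (f i - f j) ^ 2 = (max (f i - f j) 0) ^ 2 + (max (f j - f i) 0) ^ 2 := by
    intro i _ j _
    rcases le_total (f i) (f j) with hij | hij
    · rw [max_eq_right (by linarith), max_eq_left (by linarith)]; ring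
    · rw [max_eq_left (by linarith), max_eq_right (by linarith)]; ring
  rw [sum_congr rfl fun i hi => sum_congr rfl (h i hi)]
  simp_rw [sum_add_distrib]
  rw [sum_comm (f := fun i j => (max (f j - f i) 0) ^ 2)]
  ring

theorem max_avg_sq_le {ι : Type*} (s : Finset ι) (g D : ι → ℝ) (hD : ∀ i ∈ s, 0 ≤ D i)
    (h : ∀ i ∈ s, g i ≤ D i) : (max (∑ i ∈ s, g i) 0) ^ 2 ≤ #s * ∑ i ∈ s, D i ^ 2 := by
  have h0 : 0 ≤ ∑ i ∈ s, D i := sum_nonneg hD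
  calc (max (∑ i ∈ s, g i) 0) ^ 2 ≤ (∑ i ∈ s, D i) ^ 2 :=
        pow_le_pow_left₀ (le_max_right _ _) (max_le (sum_le_sum h) h0) 2
    _ ≤ _ := sq_sum_le_card_mul_sum_sq

/-! ### Certified functions and their variance -/

/-- The value of `f` at `π` is certified by the entries of `π` at the positions in `S π`: it
drops by at most the number of these entries that are changed. -/
def IsCertifiedBy {n : ℕ} (f : Equiv.Perm (Fin n) → ℝ) (S : Equiv.Perm (Fin n) → Finset (Fin n)) :
    Prop :=
  ∀ π ρ : Equiv.Perm (Fin n), f π - f ρ ≤ #{i ∈ S π | π i ≠ ρ i}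

/-- Conditioning on the first entry: `decomposeFin.symm (p, e)` runs over the permutations with
value `p` at `0`. -/
theorem sum_perm_succ {n : ℕ} (g : Equiv.Perm (Fin (n + 1)) → ℝ) :
    ∑ π, g π = ∑ p, ∑ e, g (Equiv.Perm.decomposeFin.symm (p, e)) := by
  rw [← Equiv.sum_comp Equiv.Perm.decomposeFin.symm g, Fintype.sum_prod_type]

/-- Exchanging the values `p` and `q` couples the permutations that start with `p` to those that
start with `q`. -/
theorem sum_decomposeFin_swap {n : ℕ} (g : Equiv.Perm (Fin (n + 1)) → ℝ) (p q : Fin (n + 1)) :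
    ∑ e, g (Equiv.Perm.decomposeFin.symm (q, e))
      = ∑ e, g (Equiv.swap p q * Equiv.Perm.decomposeFin.symm (p, e)) := by
  have hfst : ∀ π : Equiv.Perm (Fin (n + 1)), (Equiv.Perm.decomposeFin π).1 = π 0 := by
    intro π
    obtain ⟨⟨a, e⟩, rfl⟩ := Equiv.Perm.decomposeFin.symm.surjective π
    simp
  have key : ∀ (a b : Fin (n + 1)) (e : Equiv.Perm (Fin n)),
      Equiv.Perm.decomposeFin.symm (b, (Equiv.Perm.decomposeFin
        (Equiv.swap a b * Equiv.Perm.decomposeFin.symm (a, e))).2)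
      = Equiv.swap a b * Equiv.Perm.decomposeFin.symm (a, e) := by
    intro a b e
    rw [Equiv.symm_apply_eq]
    refine Prod.ext ?_ rfl
    rw [hfst]
    simp
  symm
  refine sum_bij' (fun e _ => (Equiv.Perm.decomposeFin
      (Equiv.swap p q * Equiv.Perm.decomposeFin.symm (p, e))).2)
    (fun e _ => (Equiv.Perm.decomposeFin
      (Equiv.swap q p * Equiv.Perm.decomposeFin.symm (q, e))).2)
    (by simp) (by simp) ?_ ?_ ?_
  · intro e _
    rw [key, Equiv.swap_comm q p, ← mul_assoc, Equiv.swap_mul_self, one_mul,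
      Equiv.apply_symm_apply]
  · intro e _
    rw [key, Equiv.swap_comm q p, ← mul_assoc, Equiv.swap_mul_self, one_mul,
      Equiv.apply_symm_apply]
  · intro e _
    rw [key]

/-- `[0 ∈ S π] + [π⁻¹ q ∈ S π]`, as a bound for the effect of the transposition of the values
`π 0` and `q`. -/
theorem IsCertifiedBy.swap_le {n : ℕ} {f : Equiv.Perm (Fin (n + 1)) → ℝ}
    {S : Equiv.Perm (Fin (n + 1)) → Finset (Fin (n + 1))} (h : IsCertifiedBy f S)
    (π : Equiv.Perm (Fin (n + 1))) (q : Fin (n + 1)) :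
    f π - f (Equiv.swap (π 0) q * π)
      ≤ (if 0 ∈ S π then 1 else 0) + (if π⁻¹ q ∈ S π then 1 else 0) := by
  refine (h _ _).trans ?_
  have hsub : {i ∈ S π | π i ≠ (Equiv.swap (π 0) q * π) i}
      ⊆ (if 0 ∈ S π then {0} else ∅) ∪ (if π⁻¹ q ∈ S π then {π⁻¹ q} else ∅) := by
    intro i hi
    rw [mem_filter] at hi
    obtain ⟨hi, hne⟩ := hi
    rw [mem_union]
    by_cases h0 : i = 0
    · subst h0; left; rw [if_pos hi]; simp
    · by_cases hq : π i = q
      · right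
        have : i = π⁻¹ q := by rw [← hq]; simp
        rw [← this, if_pos hi]; simp
      · exfalso
        apply hne
        rw [Equiv.Perm.mul_apply, Equiv.swap_apply_of_ne_of_ne (by simpa using h0) hq]
  have hc := (card_le_card hsub).trans (card_union_le _ _)
  refine (Nat.cast_le.2 hc).trans ?_
  push_cast
  apply add_le_add
  · split_ifs <;> simp
  · split_ifs <;> simp

theorem sum_indicator_inv {n : ℕ} (S : Finset (Fin n)) (π : Equiv.Perm (Fin n)) :
    ∑ q, (if π⁻¹ q ∈ S then (1 : ℝ) else 0) = #S := by
  rw [Equiv.sum_comp π⁻¹ (fun i => if i ∈ S then (1 : ℝ) else 0)]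
  simp

/-- The entry `π 0` contributes little to the variance. -/
theorem IsCertifiedBy.sum_sq_mean_le {n : ℕ} {f : Equiv.Perm (Fin (n + 1)) → ℝ}
    {S : Equiv.Perm (Fin (n + 1)) → Finset (Fin (n + 1))} (h : IsCertifiedBy f S)
    (F : Fin (n + 1) → ℝ) (m : ℝ)
    (hF : ∀ p, (n.factorial : ℝ) * F p = ∑ e, f (Equiv.Perm.decomposeFin.symm (p, e)))
    (hm : ((n + 1 : ℕ) : ℝ) * m = ∑ p, F p) :
    (n.factorial : ℝ) * ∑ p, (F p - m) ^ 2
      ≤ 2 * ∑ π, ((if 0 ∈ S π then (1 : ℝ) else 0) + #(S π) / ((n + 1 : ℕ) : ℝ)) := by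
  set D : Equiv.Perm (Fin (n + 1)) → Fin (n + 1) → ℝ := fun π q =>
    (if 0 ∈ S π then 1 else 0) + (if π⁻¹ q ∈ S π then 1 else 0) with hD
  have hfac : (0 : ℝ) < n.factorial := by exact_mod_cast n.factorial_pos
  have hn : (0 : ℝ) < ((n + 1 : ℕ) : ℝ) := by positivity
  -- The certificate of a permutation bounds only a drop in `f`, hence the positive part.
  -- Cauchy–Schwarz over the coupling leaves the sum of `D ^ 2`, and `D ^ 2 ≤ 2 * D` because `D`
  -- takes only the values `0`, `1`, `2`.
  have hpair : ∀ p q, (n.factorial : ℝ) * (max (F p - F q) 0) ^ 2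
      ≤ 2 * ∑ e, D (Equiv.Perm.decomposeFin.symm (p, e)) q := by
    intro p q
    have hdiff : (n.factorial : ℝ) * (F p - F q)
        = ∑ e, (f (Equiv.Perm.decomposeFin.symm (p, e))
          - f (Equiv.swap p q * Equiv.Perm.decomposeFin.symm (p, e))) := by
      rw [mul_sub, hF, hF, sum_decomposeFin_swap f p q, sum_sub_distrib]
    have h1 := max_avg_sq_le (univ : Finset (Equiv.Perm (Fin n)))
      (fun e => f (Equiv.Perm.decomposeFin.symm (p, e))
          - f (Equiv.swap p q * Equiv.Perm.decomposeFin.symm (p, e)))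
      (fun e => D (Equiv.Perm.decomposeFin.symm (p, e)) q)
      (fun e _ => by simp only [hD]; positivity)
      (fun e _ => by
        have := h.swap_le (Equiv.Perm.decomposeFin.symm (p, e)) q
        rwa [Equiv.Perm.decomposeFin_symm_apply_zero] at this)
    rw [← hdiff, card_univ, Fintype.card_perm, Fintype.card_fin] at h1
    have h2 : max ((n.factorial : ℝ) * (F p - F q)) 0 = n.factorial * max (F p - F q) 0 := by
      rw [mul_max_of_nonneg _ _ hfac.le, mul_zero]
    rw [h2, mul_pow, sq (n.factorial : ℝ), mul_assoc] at h1
    have h3 := le_of_mul_le_mul_left h1 hfac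
    refine h3.trans ?_
    rw [mul_sum]
    refine sum_le_sum fun e _ => ?_
    simp only [hD]
    split_ifs <;> norm_num
  have h4 : 2 * ((n + 1 : ℕ) : ℝ) * ∑ p, (F p - m) ^ 2
      = 2 * ∑ p, ∑ q, (max (F p - F q) 0) ^ 2 := by
    rw [← sum_sum_max_sq, sum_sum_sq_sub univ F m (by simpa using hm)]
    simp
  have h5 : ∑ π, ∑ q, D π q
      = ((n + 1 : ℕ) : ℝ) * ∑ π, ((if 0 ∈ S π then (1 : ℝ) else 0) + #(S π) / ((n + 1 : ℕ) : ℝ)) := by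
    rw [mul_sum]
    refine sum_congr rfl fun π _ => ?_
    simp only [hD]
    rw [sum_add_distrib, sum_indicator_inv, mul_add, mul_div_cancel₀ _ hn.ne']
    simp
  have h6 : (n.factorial : ℝ) * ∑ p, ∑ q, (max (F p - F q) 0) ^ 2 ≤ 2 * ∑ π, ∑ q, D π q := by
    rw [sum_perm_succ, mul_sum, mul_sum]
    refine sum_le_sum fun p _ => ?_
    rw [mul_sum, sum_comm, mul_sum]
    exact sum_le_sum fun q _ => hpair p q
  rw [h5] at h6
  refine le_of_mul_le_mul_left ?_ hn
  nlinarith [h4, h6]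

/-- The variance of a certified function of a uniform permutation is at most the expected size
of the certificate, up to a logarithmic factor. -/
theorem IsCertifiedBy.sum_sq_le {n : ℕ} {f : Equiv.Perm (Fin n) → ℝ}
    {S : Equiv.Perm (Fin n) → Finset (Fin n)} (h : IsCertifiedBy f S) (m : ℝ)
    (hm : (n.factorial : ℝ) * m = ∑ π, f π) :
    ∑ π, (f π - m) ^ 2 ≤ 2 * (1 + harmonic n) * ∑ π, (#(S π) : ℝ) := by
  induction n generalizing m with
  | zero =>
    simp only [univ_unique, sum_singleton, Nat.factorial_zero, Nat.cast_one, one_mul] at hm ⊢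
    rw [hm, sub_self]
    simp
  | succ n ih =>
    have hfac : (0 : ℝ) < n.factorial := by exact_mod_cast n.factorial_pos
    set F : Fin (n + 1) → ℝ := fun p =>
      (∑ e, f (Equiv.Perm.decomposeFin.symm (p, e))) / n.factorial with hFdef
    have hF : ∀ p, (n.factorial : ℝ) * F p = ∑ e, f (Equiv.Perm.decomposeFin.symm (p, e)) :=
      fun p => mul_div_cancel₀ _ hfac.ne'
    have hmF : ((n + 1 : ℕ) : ℝ) * m = ∑ p, F p := by
      apply mul_left_cancel₀ hfac.ne'
      rw [mul_sum, sum_congr rfl fun p _ => hF p, ← sum_perm_succ, ← hm, Nat.factorial_succ]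
      push_cast
      ring
    have hmean := h.sum_sq_mean_le F m hF hmF
    -- Once the first entry is fixed, the certified positions other than `0` still certify the
    -- conditional function.
    set T : Fin (n + 1) → Equiv.Perm (Fin n) → Finset (Fin n) := fun p e =>
      {i | i.succ ∈ S (Equiv.Perm.decomposeFin.symm (p, e))} with hT
    have hcard : ∀ p e, (#(S (Equiv.Perm.decomposeFin.symm (p, e))) : ℝ)
        = (if 0 ∈ S (Equiv.Perm.decomposeFin.symm (p, e)) then 1 else 0) + #(T p e) := by
      intro p e
      have h1 : ∀ s : Finset (Fin (n + 1)), (#s : ℝ) = ∑ i, if i ∈ s then (1 : ℝ) else 0 := by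
        intro s; simp
      rw [h1, Fin.sum_univ_succ]
      simp [hT]
    have hcert : ∀ p, IsCertifiedBy (fun e => f (Equiv.Perm.decomposeFin.symm (p, e))) (T p) := by
      intro p e e'
      refine (h _ _).trans ?_
      rw [Nat.cast_le, ← card_map (Fin.succEmb n)]
      refine card_le_card fun i hi => ?_
      rw [mem_filter] at hi
      obtain ⟨hi, hne⟩ := hi
      rw [Finset.mem_map]
      induction i using Fin.cases with
      | zero => simp at hne
      | succ i =>
        refine ⟨i, ?_, rfl⟩
        simp only [hT, mem_filter, mem_univ, true_and]
        refine ⟨hi, fun heq => hne ?_⟩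
        simp [heq]
    -- Law of total variance: the variance given the first entry, bounded by induction, plus the
    -- contribution of the conditional mean. The latter costs `#(S π) / (n + 1)` at each stage,
    -- which accumulates to the harmonic number.
    have hinner : ∀ p, ∑ e, (f (Equiv.Perm.decomposeFin.symm (p, e)) - m) ^ 2
        ≤ 2 * (1 + harmonic n) * ∑ e, (#(T p e) : ℝ) + n.factorial * (F p - m) ^ 2 := by
      intro p
      rw [sum_sq_sub_eq univ (fun e => f (Equiv.Perm.decomposeFin.symm (p, e))) (F p) m
        (by rw [card_univ, Fintype.card_perm, Fintype.card_fin]; exact hF p),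
        card_univ, Fintype.card_perm, Fintype.card_fin]
      exact add_le_add_left (ih (hcert p) (F p) (hF p)) _
    have hH : (0 : ℝ) ≤ harmonic n := by
      simp only [harmonic]; push_cast; positivity
    rw [sum_perm_succ]
    refine (sum_le_sum fun p _ => hinner p).trans ?_
    rw [sum_add_distrib, ← mul_sum, ← mul_sum]
    refine (add_le_add_right hmean _).trans ?_
    rw [sum_perm_succ (fun π => (#(S π) : ℝ)), sum_perm_succ]
    simp_rw [hcard, add_div, sum_add_distrib, ← sum_div]
    rw [harmonic_succ]
    push_cast
    set X := ∑ p, ∑ e, (if 0 ∈ S (Equiv.Perm.decomposeFin.symm (p, e)) then (1 : ℝ) else 0)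
    set Y := ∑ p, ∑ e, (#(T p e) : ℝ)
    have hX : 0 ≤ X := sum_nonneg fun p _ => sum_nonneg fun e _ => by positivity
    have := mul_nonneg hH hX
    simp only [div_eq_mul_inv]
    nlinarith

end Variance

/-! ### Longest subwords with pattern in a class -/

section WordLength

variable {α : Type*}

/-- The maximum length of a subsequence of the word `x` whose pattern belongs to `A`. -/
noncomputable def wordLength [LT α] (A : PermSet) {n : ℕ} (x : Fin n → α) : ℕ :=
  sSup {k | ∃ f : Fin k ↪o Fin n, ∃ σ ∈ A k, HasPattern (fun s => x (f s)) σ}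

theorem longestLength_eq_wordLength (A : PermSet) {n : ℕ} (π : Equiv.Perm (Fin n)) :
    longestLength A π = wordLength A π := rfl

theorem wordLength_bddAbove [LT α] (A : PermSet) {n : ℕ} (x : Fin n → α) :
    BddAbove {k | ∃ f : Fin k ↪o Fin n, ∃ σ ∈ A k, HasPattern (fun s => x (f s)) σ} := by
  refine ⟨n, ?_⟩
  rintro k ⟨f, -⟩
  simpa using Fintype.card_le_of_injective f f.injective

theorem le_wordLength [LT α] {A : PermSet} {n k : ℕ} {x : Fin n → α} (f : Fin k ↪o Fin n)
    {σ : Equiv.Perm (Fin k)} (hσ : σ ∈ A k) (h : HasPattern (x ∘ f) σ) : k ≤ wordLength A x :=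
  le_csSup (wordLength_bddAbove A x) ⟨f, σ, hσ, h⟩

theorem wordLength_eq_zero_or [LT α] (A : PermSet) {n : ℕ} (x : Fin n → α) :
    wordLength A x = 0 ∨
      ∃ f : Fin (wordLength A x) ↪o Fin n, ∃ σ ∈ A (wordLength A x), HasPattern (x ∘ f) σ := by
  rcases Set.eq_empty_or_nonempty
    {k | ∃ f : Fin k ↪o Fin n, ∃ σ ∈ A k, HasPattern (fun s => x (f s)) σ} with h | h
  · left
    rw [wordLength, h, csSup_empty]
    rfl
  · right
    exact Nat.sSup_mem h (wordLength_bddAbove A x)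

theorem length_le_wordLength [LT α] {A : PermSet} {n : ℕ} {x : Fin n → α} {s : List α}
    (hs : s.Sublist (List.ofFn x)) (h : ListIn A s) : s.length ≤ wordLength A x := by
  obtain ⟨k, f, rfl⟩ := sublist_ofFn_iff.1 hs
  obtain ⟨σ, hσ, hx⟩ := listIn_ofFn.1 h
  simpa using le_wordLength f hσ hx

theorem HasPattern.wordLength_eq [LT α] {n : ℕ} {x : Fin n → α} {τ : Equiv.Perm (Fin n)}
    (h : HasPattern x τ) (A : PermSet) : wordLength A x = longestLength A τ := by
  rw [wordLength, longestLength]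
  congr 1
  ext k
  exact exists_congr fun f => exists_congr fun σ => and_congr_right fun _ =>
    ⟨fun hx => h.of_trans hx, fun hx => h.trans hx⟩

theorem wordLength_mono [LT α] {A B : PermSet} (hAB : ∀ n, A n ⊆ B n) {n : ℕ} (x : Fin n → α) :
    wordLength A x ≤ wordLength B x := by
  rcases wordLength_eq_zero_or A x with h | ⟨f, σ, hσ, h⟩
  · rw [h]; exact Nat.zero_le _
  · exact le_wordLength f (hAB _ hσ) h

/-- Rotated subsequences are found, up to a short block, in one of a few rotations. -/
theorem longestLength_rot_le {A : PermSet} (hA : IsHereditary A) {n b M : ℕ} (hb : 0 < b)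
    (hbn : b ≤ n) (hM : n / b ≤ M) (π : Equiv.Perm (Fin n)) :
    ∃ j ∈ Finset.range (M + 1), longestLength (Rot A) π ≤
      longestLength A (π * finRotate n ^ (j * b))
        + wordLength A (⇑(π * finRotate n ^ (j * b)) ∘ Fin.castLE hbn) := by
  rcases wordLength_eq_zero_or (Rot A) π with h | ⟨f, σ, hσ, h⟩
  · exact ⟨0, by simp, by rw [longestLength_eq_wordLength, h]; exact Nat.zero_le _⟩
  obtain ⟨u, v, huv, hin⟩ := listIn_rot_iff_append.1 (listIn_ofFn.2 ⟨σ, hσ, h⟩)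
  have hlen : longestLength (Rot A) π = u.length + v.length := by
    rw [← List.length_append, ← huv, List.length_ofFn, longestLength_eq_wordLength]
  have hsub : (u ++ v).Sublist (List.ofFn π) := huv ▸ sublist_ofFn_iff.2 ⟨_, f, rfl⟩
  obtain ⟨l₁, l₂, hl, hu, hv⟩ := List.append_sublist_iff.1 hsub
  have hn : l₁.length ≤ n := by
    have := congrArg List.length hl
    simp only [List.length_ofFn, List.length_append] at this
    omega
  -- The cut point is rounded down to `j * b`. Then `π = a ++ c ++ l₂` with `c` shorter than `b`,
  -- and `u` splits into `u₁` inside `a` and `u₂` inside `c`.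
  set j := l₁.length / b with hj
  have htl : j * b ≤ l₁.length := Nat.div_mul_le_self _ _
  have hlt : l₁.length - j * b < b := by
    have := Nat.lt_div_mul_add hb (a := l₁.length)
    rw [← hj] at this
    omega
  rw [← List.take_append_drop (j * b) l₁] at hu hl
  set a := l₁.take (j * b) with ha
  set c := l₁.drop (j * b) with hc
  have hal : a.length = j * b := by rw [ha, List.length_take, min_eq_left htl]
  have hcl : c.length ≤ b := by rw [hc, List.length_drop]; exact hlt.le
  obtain ⟨u₁, u₂, rfl, hu₁, hu₂⟩ := List.sublist_append_iff.1 hu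
  have hrot : List.ofFn (⇑π ∘ ⇑(finRotate n ^ (j * b))) = c ++ (l₂ ++ a) := by
    rw [ofFn_comp_finRotate_pow, hl, List.append_assoc, ← hal, List.rotate_append_length_eq,
      List.append_assoc]
  refine ⟨j, Finset.mem_range.2 (Nat.lt_succ_of_le ((Nat.div_le_div_right hn).trans hM)), ?_⟩
  -- The rotated word is `c ++ l₂ ++ a`: it contains `v ++ u₁` after `c`, and `u₂` within its first
  -- `b` entries.
  have h1 : (v ++ u₁).length ≤ longestLength A (π * finRotate n ^ (j * b)) := by
    rw [longestLength_eq_wordLength]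
    refine length_le_wordLength ?_ (hin.sublist hA ?_)
    · rw [Equiv.Perm.coe_mul, hrot]
      exact (hv.append hu₁).trans (List.sublist_append_right _ _)
    · exact (List.Sublist.refl v).append (List.sublist_append_left _ _)
  have h2 : u₂.length ≤ wordLength A (⇑(π * finRotate n ^ (j * b)) ∘ Fin.castLE hbn) := by
    refine length_le_wordLength ?_ (hin.sublist hA ?_)
    · have : List.ofFn (⇑(π * finRotate n ^ (j * b)) ∘ Fin.castLE hbn)
          = (List.ofFn ⇑(π * finRotate n ^ (j * b))).take b :=
        Fin.ofFn_take_eq_take_ofFn hbn _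
      rw [this, Equiv.Perm.coe_mul, hrot, List.take_append, List.take_of_length_le hcl]
      exact hu₂.trans (List.sublist_append_left _ _)
    · exact (List.sublist_append_right _ _).trans (List.sublist_append_right _ _)
  rw [hlen]
  simp only [List.length_append] at h1 ⊢
  omega

end WordLength

/-! ### Concentration -/

section Concentration

open Finset

/-- `S` is the set of positions of a longest subsequence. The entries on which `ρ` agrees with `π`
still form a subsequence with pattern in `A`, by heredity. -/
theorem exists_certificate {A : PermSet} (hA : IsHereditary A) {n : ℕ} (π : Equiv.Perm (Fin n)) :
    ∃ S : Finset (Fin n), #S = longestLength A π ∧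
      ∀ ρ : Equiv.Perm (Fin n), longestLength A π ≤ #{i ∈ S | π i ≠ ρ i} + longestLength A ρ := by
  rcases wordLength_eq_zero_or A π with h | ⟨f, σ, hσ, h⟩
  · exact ⟨∅, by simp [longestLength_eq_wordLength, h], by simp [longestLength_eq_wordLength, h]⟩
  rw [longestLength_eq_wordLength]
  refine ⟨univ.map f.toEmbedding, by simp, fun ρ => ?_⟩
  set T : Finset (Fin (wordLength A π)) := {s | π (f s) = ρ (f s)} with hT
  have hcard : #{i ∈ univ.map f.toEmbedding | π i ≠ ρ i}
      = #{s : Fin (wordLength A π) | π (f s) ≠ ρ (f s)} := by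
    rw [filter_map, card_map]
    rfl
  have hsum : #T + #{s : Fin (wordLength A π) | π (f s) ≠ ρ (f s)} = wordLength A π := by
    rw [hT, card_filter_add_card_filter_not, card_univ, Fintype.card_fin]
  have hρ : #T ≤ longestLength A ρ := by
    set g := T.orderEmbOfFin rfl with hg
    obtain ⟨τ, hτ⟩ := exists_hasPattern (h.injective.comp g.injective)
    have heq : (⇑π ∘ ⇑f) ∘ ⇑g = ⇑ρ ∘ ⇑(g.trans f) := by
      funext s
      have := T.orderEmbOfFin_mem rfl s
      exact (mem_filter.1 this).2
    refine le_wordLength (g.trans f) (hA ⟨g, h.of_trans hτ⟩ hσ) ?_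
    rwa [← heq]
  rw [hcard]
  omega

/-! ### Means and mean absolute deviations -/

theorem factorial_mul_meanLongest (A : PermSet) (n : ℕ) :
    (n.factorial : ℝ) * meanLongest A n = ∑ π : Equiv.Perm (Fin n), (longestLength A π : ℝ) :=
  mul_div_cancel₀ _ (by exact_mod_cast n.factorial_ne_zero)

theorem meanLongest_nonneg (A : PermSet) (n : ℕ) : 0 ≤ meanLongest A n := by
  unfold meanLongest; positivity

/-- The mean absolute deviation of `L_A(Π_n)`. -/
noncomputable def meanDeviation (A : PermSet) (n : ℕ) : ℝ :=
  (∑ π : Equiv.Perm (Fin n), |(longestLength A π : ℝ) - meanLongest A n|) / (n.factorial : ℝ)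

theorem factorial_mul_meanDeviation (A : PermSet) (n : ℕ) :
    (n.factorial : ℝ) * meanDeviation A n
      = ∑ π : Equiv.Perm (Fin n), |(longestLength A π : ℝ) - meanLongest A n| :=
  mul_div_cancel₀ _ (by exact_mod_cast n.factorial_ne_zero)

/-- The certificate has size `L_A(π)` itself, so the variance is bounded by the mean up to a
logarithm; Cauchy–Schwarz passes to the absolute deviation. -/
theorem meanDeviation_le {A : PermSet} (hA : IsHereditary A) (n : ℕ) :
    meanDeviation A n ≤ √(2 * (1 + harmonic n) * meanLongest A n) := by
  choose S hS hcert using fun π : Equiv.Perm (Fin n) => exists_certificate hA π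
  have h : IsCertifiedBy (fun π => (longestLength A π : ℝ)) S := by
    intro π ρ
    simp only [sub_le_iff_le_add]
    exact_mod_cast hcert π ρ
  have hvar := h.sum_sq_le (meanLongest A n) (factorial_mul_meanLongest A n)
  simp only [hS] at hvar
  rw [← factorial_mul_meanLongest] at hvar
  have hfac : (0 : ℝ) < n.factorial := by exact_mod_cast n.factorial_pos
  apply Real.le_sqrt_of_sq_le
  have hcs := sq_sum_le_card_mul_sum_sq (s := univ)
    (f := fun π : Equiv.Perm (Fin n) => |(longestLength A π : ℝ) - meanLongest A n|)
  rw [← factorial_mul_meanDeviation, card_univ, Fintype.card_perm, Fintype.card_fin] at hcs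
  simp only [sq_abs] at hcs
  have hcs' := hcs.trans (mul_le_mul_of_nonneg_left hvar hfac.le)
  rw [mul_pow, sq (n.factorial : ℝ), mul_assoc] at hcs'
  have h2 := le_of_mul_le_mul_left hcs' hfac
  refine le_of_mul_le_mul_left (h2.trans_eq ?_) hfac
  ring

/-- The pattern of the first `b` entries of a uniform permutation is uniform. -/
theorem sum_wordLength_take (A : PermSet) {n b : ℕ} (hbn : b ≤ n) (φ : ℕ → ℝ) :
    (b.factorial : ℝ) * ∑ π : Equiv.Perm (Fin n), φ (wordLength A (π ∘ Fin.castLE hbn))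
      = n.factorial * ∑ σ : Equiv.Perm (Fin b), φ (longestLength A σ) := by
  set ι : Fin b ↪ Fin n := Fin.castLEEmb hbn with hι
  -- Shuffling the first `b` positions by `σ` only reindexes the sum over `π`.
  have h1 : ∀ σ : Equiv.Perm (Fin b),
      ∑ π : Equiv.Perm (Fin n), φ (wordLength A (π ∘ Fin.castLE hbn))
        = ∑ π : Equiv.Perm (Fin n), φ (wordLength A ((π ∘ Fin.castLE hbn) ∘ σ)) := by
    intro σ
    rw [← Equiv.sum_comp (Equiv.mulRight (σ.viaEmbedding ι))]
    refine sum_congr rfl fun π _ => ?_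
    congr 2
    funext i
    exact congrArg π (Equiv.Perm.viaEmbedding_apply σ ι i)
  -- With `τ` the pattern of the first `b` entries, the shuffled patterns `τ * σ` run over all
  -- permutations of length `b`.
  have h2 : ∀ π : Equiv.Perm (Fin n),
      ∑ σ : Equiv.Perm (Fin b), φ (wordLength A ((π ∘ Fin.castLE hbn) ∘ σ))
        = ∑ σ : Equiv.Perm (Fin b), φ (longestLength A σ) := by
    intro π
    obtain ⟨τ, hτ⟩ := exists_hasPattern (π.injective.comp (Fin.castLE_injective hbn))
    rw [← Equiv.sum_comp (Equiv.mulLeft τ) (fun σ => φ (longestLength A σ))]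
    exact sum_congr rfl fun σ _ => congrArg φ ((hτ.comp_perm σ).wordLength_eq A)
  calc (b.factorial : ℝ) * ∑ π : Equiv.Perm (Fin n), φ (wordLength A (π ∘ Fin.castLE hbn))
      = ∑ _σ : Equiv.Perm (Fin b),
        ∑ π : Equiv.Perm (Fin n), φ (wordLength A (π ∘ Fin.castLE hbn)) := by
        rw [sum_const, card_univ, Fintype.card_perm, Fintype.card_fin, nsmul_eq_mul]
    _ = ∑ π : Equiv.Perm (Fin n), ∑ σ : Equiv.Perm (Fin b),
        φ (wordLength A ((π ∘ Fin.castLE hbn) ∘ σ)) := by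
        rw [sum_congr rfl fun σ _ => h1 σ, sum_comm]
    _ = _ := by
        rw [sum_congr rfl fun π _ => h2 π, sum_const, card_univ, Fintype.card_perm,
          Fintype.card_fin, nsmul_eq_mul]

/-- The maximum over the `M + 1` rotations is bounded by the two means plus the sum of all absolute
deviations; since every rotation of a uniform permutation is uniform, these have equal expectations.
-/
theorem meanLongest_rot_le {A : PermSet} (hA : IsHereditary A) {n b M : ℕ} (hb : 0 < b)
    (hbn : b ≤ n) (hM : n / b ≤ M) :
    meanLongest (Rot A) n ≤ meanLongest A n + meanLongest A b
      + (M + 1) * (meanDeviation A n + meanDeviation A b) := by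
  have hn : (0 : ℝ) < n.factorial := by exact_mod_cast n.factorial_pos
  have hb' : (0 : ℝ) < b.factorial := by exact_mod_cast b.factorial_pos
  set X : Equiv.Perm (Fin n) → ℝ := fun π => |(longestLength A π : ℝ) - meanLongest A n|
    + |(wordLength A (π ∘ Fin.castLE hbn) : ℝ) - meanLongest A b| with hX
  have hX0 : ∀ π, 0 ≤ X π := fun π => add_nonneg (abs_nonneg _) (abs_nonneg _)
  have hXsum : ∑ π, X π = n.factorial * (meanDeviation A n + meanDeviation A b) := by
    rw [hX, sum_add_distrib, mul_add, factorial_mul_meanDeviation]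
    congr 1
    have := sum_wordLength_take A hbn (fun k => |(k : ℝ) - meanLongest A b|)
    rw [← factorial_mul_meanDeviation] at this
    apply mul_left_cancel₀ hb'.ne'
    rw [this]
    ring
  have hpt : ∀ π : Equiv.Perm (Fin n), (longestLength (Rot A) π : ℝ) ≤
      (meanLongest A n + meanLongest A b)
        + ∑ j ∈ range (M + 1), X (π * finRotate n ^ (j * b)) := by
    intro π
    obtain ⟨j, hj, h⟩ := longestLength_rot_le hA hb hbn hM π
    have h1 := single_le_sum (f := fun j => X (π * finRotate n ^ (j * b)))
      (fun j _ => hX0 _) hj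
    have h2 : (longestLength (Rot A) π : ℝ) ≤ longestLength A (π * finRotate n ^ (j * b))
        + wordLength A (⇑(π * finRotate n ^ (j * b)) ∘ Fin.castLE hbn) := by exact_mod_cast h
    have h3 := le_abs_self ((longestLength A (π * finRotate n ^ (j * b)) : ℝ) - meanLongest A n)
    have h4 := le_abs_self ((wordLength A (⇑(π * finRotate n ^ (j * b)) ∘ Fin.castLE hbn) : ℝ)
      - meanLongest A b)
    simp only [hX] at h1 ⊢
    linarith
  apply le_of_mul_le_mul_left _ hn
  rw [factorial_mul_meanLongest]
  refine (sum_le_sum fun π _ => hpt π).trans_eq ?_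
  have hrot : ∀ j ∈ range (M + 1), ∑ π, X (π * finRotate n ^ (j * b)) = ∑ π, X π :=
    fun j _ => Equiv.sum_comp (Equiv.mulRight (finRotate n ^ (j * b))) X
  rw [sum_add_distrib, sum_comm, sum_const, card_univ, Fintype.card_perm, Fintype.card_fin,
    nsmul_eq_mul, sum_congr rfl hrot, hXsum, sum_const, card_range, nsmul_eq_mul]
  push_cast
  ring

end Concentration

/-! ### Growth rates of `Rot A` -/

theorem finRotate_pow_mod (n k : ℕ) : finRotate n ^ (k % n) = finRotate n ^ k := by
  ext i
  rw [val_finRotate_pow, val_finRotate_pow, Nat.add_mod_mod]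

theorem ncard_rot_le (A : PermSet) {n : ℕ} (hn : 0 < n) :
    (Rot A n).ncard ≤ n * (A n).ncard := by
  have hsub : Rot A n ⊆ (fun p : Fin n × Equiv.Perm (Fin n) => p.2 * finRotate n ^ (p.1 : ℕ)) ''
      (Set.univ ×ˢ A n) := by
    rintro _ ⟨π, hπ, k, rfl⟩
    exact ⟨(⟨k % n, Nat.mod_lt k hn⟩, π), ⟨trivial, hπ⟩, by simp [finRotate_pow_mod]⟩
  refine (Set.ncard_le_ncard hsub (Set.toFinite _)).trans ((Set.ncard_image_le
    (Set.toFinite _)).trans_eq ?_)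
  rw [Set.ncard_prod, Set.ncard_univ, Nat.card_eq_fintype_card, Fintype.card_fin]

theorem tendsto_natCast_rpow_one_div :
    Tendsto (fun n : ℕ => (n : ℝ≥0∞) ^ (1 / (n : ℝ))) atTop (𝓝 1) := by
  have h := ENNReal.tendsto_ofReal (tendsto_rpow_div.comp tendsto_natCast_atTop_atTop)
  rw [ENNReal.ofReal_one] at h
  refine h.congr fun n => ?_
  rw [Function.comp_apply, ← ENNReal.ofReal_rpow_of_nonneg (by positivity) (by positivity),
    ENNReal.ofReal_natCast]

/-- Squeezed between `growthRoot A` and its product with `n ^ (1 / n)`. -/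
theorem tendsto_growthRoot_rot {A : PermSet} {s : ℝ≥0∞}
    (h : Tendsto (growthRoot A) atTop (𝓝 s)) : Tendsto (growthRoot (Rot A)) atTop (𝓝 s) := by
  have hup : Tendsto (fun n : ℕ => (n : ℝ≥0∞) ^ (1 / (n : ℝ)) * growthRoot A n) atTop (𝓝 s) := by
    simpa using ENNReal.Tendsto.mul tendsto_natCast_rpow_one_div (.inl one_ne_zero) h
      (.inr ENNReal.one_ne_top)
  refine tendsto_of_tendsto_of_tendsto_of_le_of_le' h hup (.of_forall fun n => ?_) ?_
  · refine ENNReal.rpow_le_rpow ?_ (by positivity)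
    exact_mod_cast Set.ncard_le_ncard (subset_rot A n) (Set.toFinite _)
  · filter_upwards [eventually_gt_atTop 0] with n hn
    rw [growthRoot, growthRoot, ← ENNReal.mul_rpow_of_nonneg _ _ (by positivity)]
    refine ENNReal.rpow_le_rpow ?_ (by positivity)
    exact_mod_cast ncard_rot_le A hn

/-! ### Longest subsequences of random permutations with pattern in `Rot A` -/

theorem meanLongest_mono {A B : PermSet} (hAB : ∀ n, A n ⊆ B n) (n : ℕ) :
    meanLongest A n ≤ meanLongest B n := by
  unfold meanLongest
  gcongr with π
  exact wordLength_mono hAB π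

theorem meanDeviation_le_of_le {A : PermSet} (hA : IsHereditary A) {C : ℝ} (hC : 0 ≤ C)
    (hbd : ∀ n, 0 < n → meanLongest A n ≤ C * √n) {k n : ℕ} (hk : 0 < k) (hkn : k ≤ n) :
    meanDeviation A k ≤ √(2 * (2 + Real.log n) * (C * √n)) := by
  refine (meanDeviation_le hA k).trans (Real.sqrt_le_sqrt ?_)
  have hk' : (0 : ℝ) < k := by exact_mod_cast hk
  have hkn' : (k : ℝ) ≤ n := by exact_mod_cast hkn
  have h1 : (harmonic k : ℝ) ≤ 1 + Real.log n :=
    (harmonic_le_one_add_log k).trans (by gcongr)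
  have h2 : meanLongest A k ≤ C * √n := (hbd k hk).trans (by gcongr)
  have h3 : 0 ≤ Real.log n := Real.log_nonneg (by exact_mod_cast hk.trans_le hkn)
  have h4 := meanLongest_nonneg A k
  apply mul_le_mul _ h2 h4 (by positivity)
  linarith

/-! ### Asymptotics of the mean for `Rot A` -/

theorem meanLongest_rot_div_le {A : PermSet} (hA : IsHereditary A) {C : ℝ} (hC : 0 ≤ C)
    (hbd : ∀ n, 0 < n → meanLongest A n ≤ C * √n) {M n : ℕ} (hM : 2 ≤ M) (hn : 2 ≤ n) :
    meanLongest (Rot A) n / √n ≤ meanLongest A n / √n + (C * √(1 / M + 1 / n)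
      + 2 * (M + 1) * √(2 * (2 + Real.log n) * C / √n)) := by
  have hn0 : (0 : ℝ) < n := by exact_mod_cast (by omega : 0 < n)
  have hM0 : (0 : ℝ) < M := by exact_mod_cast (by omega : 0 < M)
  have hs : 0 < √(n : ℝ) := Real.sqrt_pos.2 hn0
  -- The `+ 1` makes `M * b ≥ n`, so that `n / b ≤ M`; it is also the source of the term `1 / n`
  -- under the root. That `b ≤ n` uses `2 ≤ M` and `2 ≤ n`.
  set b := n / M + 1 with hb
  have hb0 : 0 < b := Nat.succ_pos _
  have hbn : b ≤ n := by
    have := Nat.div_le_div_left hM two_pos (a := n)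
    omega
  have hnb : n / b ≤ M := by
    apply Nat.div_le_of_le_mul
    have := Nat.lt_div_mul_add (by omega : 0 < M) (a := n)
    rw [hb, add_mul, one_mul]
    exact this.le
  have hD : ∀ k, 0 < k → k ≤ n →
      meanDeviation A k ≤ √(2 * (2 + Real.log n) * C / √n) * √n := by
    intro k hk hkn
    refine (meanDeviation_le_of_le hA hC hbd hk hkn).trans_eq ?_
    rw [← Real.sqrt_mul' _ hn0.le]
    congr 1
    have := Real.mul_self_sqrt hn0.le
    field_simp
    rw [sq, this]
  have hB : meanLongest A b ≤ C * √(1 / M + 1 / n) * √n := by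
    refine (hbd b hb0).trans ?_
    rw [mul_assoc, ← Real.sqrt_mul' _ hn0.le]
    refine mul_le_mul_of_nonneg_left (Real.sqrt_le_sqrt ?_) hC
    have h1 : ((n / M : ℕ) : ℝ) ≤ (n : ℝ) / M := Nat.cast_div_le
    rw [hb]
    push_cast
    have h2 : (1 / (M : ℝ) + 1 / n) * n = n / M + 1 := by field_simp
    linarith
  have hmain := meanLongest_rot_le hA hb0 hbn hnb
  have h1 := hD n (by omega) le_rfl
  have h2 := hD b hb0 hbn
  rw [div_le_iff₀ hs, add_mul, div_mul_cancel₀ _ hs.ne']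
  have h3 := mul_le_mul_of_nonneg_left (add_le_add h1 h2) (by positivity : (0 : ℝ) ≤ M + 1)
  linarith

theorem tendsto_error (C : ℝ) (M : ℕ) :
    Tendsto (fun n : ℕ => C * √(1 / M + 1 / n) + 2 * (M + 1) * √(2 * (2 + Real.log n) * C / √n))
      atTop (𝓝 (C * √(1 / M))) := by
  have h1 : Tendsto (fun n : ℕ => C * √(1 / M + 1 / n)) atTop (𝓝 (C * √(1 / M + 0))) :=
    ((tendsto_one_div_atTop_nhds_zero_nat (𝕜 := ℝ)).const_add _).sqrt.const_mul C
  have hlog : Tendsto (fun x : ℝ => Real.log x / √x) atTop (𝓝 0) := by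
    simp_rw [Real.sqrt_eq_rpow]
    exact (isLittleO_log_rpow_atTop (by norm_num : (0 : ℝ) < 1 / 2)).tendsto_div_nhds_zero
  have hinv : Tendsto (fun x : ℝ => (√x)⁻¹) atTop (𝓝 0) :=
    tendsto_inv_atTop_zero.comp Real.tendsto_sqrt_atTop
  have h2 : Tendsto (fun n : ℕ => 2 * (2 + Real.log n) * C / √n) atTop (𝓝 0) := by
    have h := ((hinv.const_mul (4 * C)).add (hlog.const_mul (2 * C))).comp
      (tendsto_natCast_atTop_atTop (R := ℝ))
    simp only [mul_zero, add_zero] at h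
    refine h.congr fun n => ?_
    simp only [Function.comp_apply]
    ring
  have h3 := h1.add (h2.sqrt.const_mul (2 * ((M : ℝ) + 1)))
  simpa using h3

theorem tendsto_meanLongest_rot {A : PermSet} (hA : IsHereditary A) {l : ℝ}
    (h : Tendsto (fun n : ℕ => meanLongest A n / √n) atTop (𝓝 l)) :
    Tendsto (fun n : ℕ => meanLongest (Rot A) n / √n) atTop (𝓝 l) := by
  obtain ⟨C, hC⟩ := h.bddAbove_range
  have hC0 : 0 ≤ C := (div_nonneg (meanLongest_nonneg A 0) (Real.sqrt_nonneg _)).trans (hC ⟨0, rfl⟩)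
  have hbd : ∀ n : ℕ, 0 < n → meanLongest A n ≤ C * √n := fun n hn =>
    (div_le_iff₀ (Real.sqrt_pos.2 (by exact_mod_cast hn))).1 (hC ⟨n, rfl⟩)
  rw [tendsto_order]
  constructor
  · intro a ha
    filter_upwards [(tendsto_order.1 h).1 a ha] with n hn
    refine hn.trans_le ?_
    gcongr
    exact meanLongest_mono (subset_rot A) n
  · intro a ha
    -- The gap is split at `d`: `M` is fixed first so that the limiting error `C * √(1 / M)` is
    -- below `a - d`, and only then is `n` taken large.
    obtain ⟨d, hld, hda⟩ := exists_between ha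
    have hM : Tendsto (fun M : ℕ => C * √(1 / M)) atTop (𝓝 0) := by
      simpa using (tendsto_one_div_atTop_nhds_zero_nat (𝕜 := ℝ)).sqrt.const_mul C
    obtain ⟨M, hM2, hMd⟩ := ((eventually_ge_atTop 2).and
      ((tendsto_order.1 hM).2 (a - d) (sub_pos.2 hda))).exists
    filter_upwards [(tendsto_order.1 h).2 d hld, (tendsto_order.1 (tendsto_error C M)).2 _ hMd,
      eventually_ge_atTop 2] with n h1 h2 h3
    have := meanLongest_rot_div_le hA hC0 hbd hM2 h3
    linarith

theorem tendsto_scaledMean_rot {A : PermSet} (hA : IsHereditary A) {l : ℝ≥0∞}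
    (h : Tendsto (scaledMean A) atTop (𝓝 l)) : Tendsto (scaledMean (Rot A)) atTop (𝓝 l) := by
  -- An infinite limit passes to the larger class by monotonicity; a finite one is needed for the
  -- bound `C * √n` on the means.
  by_cases hl : l = ⊤
  · subst hl
    refine tendsto_nhds_top_mono' h fun n => ENNReal.ofReal_le_ofReal ?_
    gcongr
    exact meanLongest_mono (subset_rot A) n
  · have hreal : Tendsto (fun n : ℕ => meanLongest A n / √n) atTop (𝓝 l.toReal) := by
      refine ((ENNReal.tendsto_toReal hl).comp h).congr fun n => ENNReal.toReal_ofReal ?_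
      exact div_nonneg (meanLongest_nonneg A n) (Real.sqrt_nonneg _)
    have := ENNReal.tendsto_ofReal (tendsto_meanLongest_rot hA hreal)
    rwa [ENNReal.ofReal_toReal hl] at this

theorem mainTheorem5 (A : PermSet) (hA : IsPatternClass A) (h : SatisfiesConjecture A) :
    IsPatternClass (Rot A) ∧ (IsProper A → IsProper (Rot A)) ∧
      SatisfiesConjecture (Rot A) ∧
      lsConst (Rot A) = lsConst A ∧ stanleyWilf (Rot A) = stanleyWilf A := by
  have hA' := isPatternClass_iff.1 hA
  obtain ⟨hmean, hgrowth, heq⟩ := h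
  have hmean' := tendsto_scaledMean_rot hA' hmean
  have hgrowth' := tendsto_growthRoot_rot hgrowth
  have hc : lsConst (Rot A) = lsConst A := by rw [lsConst, lsConst, hmean'.limsup_eq]
  have hs : stanleyWilf (Rot A) = stanleyWilf A := hgrowth'.limsup_eq
  refine ⟨isPatternClass_iff.2 hA'.rot, hA'.isProper_rot, ⟨?_, ?_, ?_⟩, hc, hs⟩
  · rwa [hmean'.limsup_eq]
  · rwa [hgrowth'.limsup_eq]
  · rw [hc, hs, heq]
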